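/- Let $G=(V,E)$ be a finite connected undirected graph with at least two vertices, without loops or multiple edges, whose edges $e\in E$ carry lengths $L_e\in(0,\infty)$. Let $\Gamma_G$ be the associated quantum graph, i.e. the space obtained from the intervals $[0,L_e]$, $e\in E$ (each edge being given an arbitrary orientation), by gluing their endpoints at the vertices, with its length (Lebesgue) measure $\mathrm{d}x$. For $y\in V$ let $d(\cdot,y)$ be the geodesic distance to $y$: for a vertex it is the length of a shortest path of edges, and for a point $x$ of coordinate $x_e$ in the interior of an edge $e$ it is $\min\{x_e+d(e(0),y),\,L_e-x_e+d(e(L_e),y)\}$. For a probability distribution $\nu$ on $V$ and $\beta\ge 0$ set $$U_\nu(x)=\frac12\sum_{y\in V}d^2(x,y)\,\nu(y),\qquad \mu_\beta(\mathrm{d}x)=\frac{1}{Z_\beta}e^{-\beta U_\nu(x)}\,\mathrm{d}x,\qquad Z_\beta=\int_{\Gamma_G}e^{-\beta U_\nu(x)}\,\mathrm{d}x,$$ $$H(x,y)=\min_{\gamma:\,x\to y}\ \max_{s\in\gamma}U_\nu(s),\qquad c^\star(U_\nu)=\max_{(x,y)\in\Gamma_G^2}\big[H(x,y)-U_\nu(x)-U_\nu(y)\big]+\min_{x\in\Gamma_G}U_\nu(x),$$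 where the minimum in $H$ is over the continuous paths $\gamma$ in $\Gamma_G$ from $x$ to $y$. Let $W^{1,2}(\mu_\beta)$ be the set of $f\in L^2(\mu_\beta)$ that agree almost everywhere with a continuous function on $\Gamma_G$ (continuous at the vertices too) and have on the interior of the edges a weak derivative $\nabla f\in L^2(\mu_\beta)$, and for such $f$ let $$\mathcal E_\beta(f,f)=\int_{\Gamma_G}|\nabla f|^2\,\mathrm{d}\mu_\beta,\qquad \mathbf{Ent}_{\mu_\beta}(f^2)=\int_{\Gamma_G}f^2\log\Big(\frac{f^2}{\|f\|_{2,\mu_\beta}^2}\Big)\,\mathrm{d}\mu_\beta ,$$ with the convention that the integrand is $0$ wherever $f=0$. Then there is a constant $C_{\Gamma_G}>0$, depending only on $\Gamma_G$ (in particular neither on $\beta$ nor on $\nu$), such that for every probability distribution $\nu$ on $V$, every $\beta\ge 0$ and every $f\in W^{1,2}(\mu_\beta)$, the integrand of $\mathbf{Ent}_{\mu_\beta}(f^2)$ is $\mu_\beta$-integrable and $$\mathbf{Ent}_{\mu_\beta}(f^2)\le C_{\Gamma_G}\,(1+\beta)\,e^{c^\star(U_\nu)\beta}\,\mathcal E_\beta(f,f).$$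 -/

import Mathlib

open MeasureTheory
open scoped ContDiff

noncomputable section

/-- A weighted graph: a connected undirected graph without loops or multiple edges,
whose edges carry symmetric positive lengths `weight i j`. The value of `weight i j` is irrelevant
when `i` and `j` are not adjacent. -/
structure WeightedGraph (V : Type*) where
  graph : SimpleGraph V
  weight : V → V → ℝ
  weight_symm : ∀ i j, graph.Adj i j → weight i j = weight j i
  weight_pos : ∀ i j, graph.Adj i j → 0 < weight i j
  connected : graph.Connected

namespace WeightedGraph

variable {V : Type*} (G : WeightedGraph V)

/-- The length of a walk: the sum of the lengths of the traversed edges. -/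
def walkLength {i j : V} (p : G.graph.Walk i j) : ℝ :=
  (p.darts.map fun a => G.weight a.fst a.snd).sum

/-- The geodesic distance between two vertices. -/
def vertexDist (i j : V) : ℝ := ⨅ p : G.graph.Walk i j, G.walkLength p

/-- The initial vertex of an edge, for an arbitrarily fixed orientation. -/
def src (e : G.graph.edgeSet) : V := (Quot.out e.1).1

/-- The terminal vertex of an edge, for the same orientation. -/
def tgt (e : G.graph.edgeSet) : V := (Quot.out e.1).2

/-- The length of an edge. -/
def len (e : G.graph.edgeSet) : ℝ := G.weight (G.src e) (G.tgt e)

/-- The points of the quantum graph: the vertices, and the points in the interior of an edge `e`,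
located by their coordinate `t` in the open interval from `0` to the length of `e`. -/
inductive Point : Type _
  | vertex (v : V) : Point
  | inner (e : G.graph.edgeSet) (t : ℝ) (ht : t ∈ Set.Ioo 0 (G.len e)) : Point

/-- The parametrization of the closed edge `e` by arc length `t`, from `src e` at `t = 0` to
`tgt e` at `t = len e`; it is extended by constants outside `[0, len e]`. -/
def param (e : G.graph.edgeSet) (t : ℝ) : G.Point :=
  if h₀ : 0 < t then
    if h₁ : t < G.len e then Point.inner e t ⟨h₀, h₁⟩ else Point.vertex (G.tgt e)
  else Point.vertex (G.src e)

/-- The topology of the quantum graph: closed intervals glued together at the vertices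
(a set is open when its preimage under the parametrization of every edge is). -/
instance instTopologicalSpacePoint : TopologicalSpace G.Point :=
  ⨆ e : G.graph.edgeSet, TopologicalSpace.coinduced (G.param e) inferInstance

instance instMeasurableSpacePoint : MeasurableSpace G.Point := borel G.Point

instance instBorelSpacePoint : BorelSpace G.Point := ⟨rfl⟩

/-- The geodesic distance from a point of the quantum graph to a vertex. -/
def distTo (y : V) : G.Point → ℝ
  | Point.vertex v => G.vertexDist v y
  | Point.inner e t _ =>
      min (t + G.vertexDist (G.src e) y) (G.len e - t + G.vertexDist (G.tgt e) y)

/-- The energy `U_ν(x) = (1/2) ∑ y, d(x, y)² ν(y)`. -/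
def energy [Fintype V] (ν : V → ℝ) (x : G.Point) : ℝ :=
  (1 / 2) * ∑ y, G.distTo y x ^ 2 * ν y

/-- The Lebesgue (length) measure `dx` on the quantum graph. -/
def lengthMeasure : Measure G.Point :=
  Measure.sum fun e : G.graph.edgeSet =>
    (volume.restrict (Set.Icc 0 (G.len e))).map (G.param e)

/-- The normalization factor `Z_β = ∫ exp (-β U(x)) dx`. -/
def partitionFunction (U : G.Point → ℝ) (β : ℝ) : ℝ :=
  ∫ x, Real.exp (-β * U x) ∂G.lengthMeasure

/-- The Gibbs measure with density `exp (-β U(x)) / Z_β` with respect to the length measure. -/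
def gibbs (U : G.Point → ℝ) (β : ℝ) : Measure G.Point :=
  G.lengthMeasure.withDensity fun x =>
    ENNReal.ofReal (Real.exp (-β * U x) / G.partitionFunction U β)

/-- The elevation `H(x, y)`: the smallest possible value, over the continuous paths from `x` to
`y`, of the highest value of `U` on the path. -/
def elevation (U : G.Point → ℝ) (x y : G.Point) : ℝ :=
  ⨅ γ : Path x y, ⨆ s : unitInterval, U (γ s)

/-- `c⋆(U) = max_{x, y} [H(x, y) - U(x) - U(y)] + min U`. -/
def cStar (U : G.Point → ℝ) : ℝ :=
  (⨆ p : G.Point × G.Point, (G.elevation U p.1 p.2 - U p.1 - U p.2)) + ⨅ x, U x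

/-- `g` is the weak (distributional) derivative of `f` with respect to the arc length parameter
in the interior of every edge. -/
def IsWeakGradient (f g : G.Point → ℝ) : Prop :=
  ∀ e : G.graph.edgeSet,
    LocallyIntegrableOn (fun t => f (G.param e t)) (Set.Ioo 0 (G.len e)) ∧
    LocallyIntegrableOn (fun t => g (G.param e t)) (Set.Ioo 0 (G.len e)) ∧
    ∀ φ : ℝ → ℝ, ContDiff ℝ ∞ φ → HasCompactSupport φ → tsupport φ ⊆ Set.Ioo 0 (G.len e) →
      ∫ t in Set.Ioo 0 (G.len e), f (G.param e t) * deriv φ t =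
        -∫ t in Set.Ioo 0 (G.len e), g (G.param e t) * φ t

open Classical in
/-- The weak gradient `∇f` (unique up to null sets; `0` if `f` is not weakly differentiable). -/
def weakGradient (f : G.Point → ℝ) : G.Point → ℝ :=
  if h : ∃ g, G.IsWeakGradient f g then h.choose else 0

/-- The Sobolev space `W^{1,2}(μ)` of the quantum graph: `f` is in `L²(μ)`, it agrees almost
everywhere with a function that is continuous on the whole graph (vertices included), and it has
a weak gradient in `L²(μ)`. -/
structure MemW12 (μ : Measure G.Point) (f : G.Point → ℝ) : Prop where
  memLp : MemLp f 2 μ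
  continuous_rep : ∃ F : G.Point → ℝ, Continuous F ∧ f =ᵐ[G.lengthMeasure] F
  weaklyDifferentiable : ∃ g, G.IsWeakGradient f g
  memLp_weakGradient : MemLp (G.weakGradient f) 2 μ

/-- The Dirichlet form `∫ |∇f|² dμ`. -/
def dirichletForm (μ : Measure G.Point) (f : G.Point → ℝ) : ℝ :=
  ∫ x, G.weakGradient f x ^ 2 ∂μ

/-- The integrand `f² log (f² / ‖f‖²_{2,μ})` of the entropy of `f²`. -/
def entropyIntegrand (μ : Measure G.Point) (f : G.Point → ℝ) (x : G.Point) : ℝ :=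
  f x ^ 2 * Real.log (f x ^ 2 / ∫ y, f y ^ 2 ∂μ)

/-- The entropy `Ent_μ(f²) = ∫ f² log (f² / ‖f‖²_{2,μ}) dμ`. -/
def entropySq (μ : Measure G.Point) (f : G.Point → ℝ) : ℝ :=
  ∫ x, G.entropyIntegrand μ f x ∂μ

end WeightedGraph

end

/-! The graph is one-dimensional, so a function is controlled pointwise by its gradient. Write `l`
for the total length and `T` for `∫ g² dμ_β`, with `g` the weak gradient of a continuous `F`. If a
path from `x` to `y` stays in `K = {U ≤ h}`, then `|F y - F x| ≤ ∫_K |g| dx`; Cauchy-Schwarz and `1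
≤ e^{βh} e^{-βU}` on `K` give `(F y - F x)² ≤ l e^{βh} Z_β T` (`sq_sub_le_of_path`), and `h` can be
brought down to the elevation `H(x, y)`. The path is merely continuous and may backtrack
indefinitely, so the first inequality is not obtained by integrating along it: the segment between
`F x` and `F y` lies in `F '' K`, whose Lebesgue measure is at most `∫_K |g|`
(`volume_image_le_lintegral_enorm`).

This increment bound is used twice. With `y` a minimum of `U`, multiplying by the Gibbs density
cancels `Z_β` and leaves the exponent `β (H(x, y) - U x) ≤ β c⋆`; integrating in `x` gives a
Poincaré inequality with constant `l² e^{c⋆ β}` (`integral_sq_sub_le`). With `H ≤ B`, where `B`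
bounds all the energies, and `Z_β ≤ l`, it gives a crude oscillation bound `l² e^{βB} T`
(`sq_sub_le_exp`).

The entropy of a function is at most its variance times the logarithm of its normalized oscillation
(`integral_sq_mul_log_sq_le_of_normalized`). The bad exponential `e^{βB}` therefore costs only a
factor of order `1 + β`, and the exponential rate is that of the Poincaré inequality. Only `l` and
`B` enter the constant, and `B` is uniform in `ν`. -/

/-! ### Functions on an interval -/

/-- If the increments of `F` are the integrals of `g`, then the image of a measurable set `A` under
`F` has Lebesgue measure at most `∫_A |g|`. -/
theorem volume_image_le_lintegral_enorm {F g : ℝ → ℝ} (hg : Integrable g)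
    (hF : ∀ s t, F t - F s = ∫ u in s..t, g u) {A : Set ℝ} (hA : MeasurableSet A) :
    volume (F '' A) ≤ ∫⁻ t in A, ‖g t‖ₑ := by
  -- On an interval, the measure of the image is at most its diameter, and every increment is an
  -- integral over a subinterval.
  have hconn : ∀ C : Set ℝ, C.OrdConnected → volume (F '' C) ≤ ∫⁻ t in C, ‖g t‖ₑ := by
    intro C hC
    refine (Real.volume_le_diam _).trans (Metric.ediam_le ?_)
    rintro _ ⟨s, hs, rfl⟩ _ ⟨t, ht, rfl⟩
    rw [edist_comm, edist_eq_enorm_sub, hF s t]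
    calc ‖∫ u in s..t, g u‖ₑ = ‖∫ u in Set.uIoc s t, g u‖ₑ := by
          rw [← ofReal_norm, ← ofReal_norm, intervalIntegral.norm_intervalIntegral_eq]
      _ ≤ ∫⁻ u in Set.uIoc s t, ‖g u‖ₑ := enorm_integral_le_lintegral_enorm _
      _ ≤ ∫⁻ u in C, ‖g u‖ₑ :=
          lintegral_mono_set (Set.uIoc_subset_uIcc.trans (hC.uIcc_subset hs ht))
  -- An open set is the countable disjoint union of its components, which are intervals;
  -- subadditivity on the left meets additivity on the right.
  have hopen : ∀ U : Set ℝ, IsOpen U → volume (F '' U) ≤ ∫⁻ t in U, ‖g t‖ₑ := by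
    intro U hU
    let S : Set (Set ℝ) := (fun x => connectedComponentIn U x) '' U
    have hSo : ∀ s ∈ S, IsOpen s := by
      rintro _ ⟨x, -, rfl⟩
      exact hU.connectedComponentIn
    have hSd : S.PairwiseDisjoint id := by
      rintro _ ⟨x, -, rfl⟩ _ ⟨y, -, rfl⟩ hne
      by_contra hd
      obtain ⟨z, hz1, hz2⟩ := Set.not_disjoint_iff.1 hd
      exact hne ((connectedComponentIn_eq hz1).trans (connectedComponentIn_eq hz2).symm)
    have hSn : ∀ s ∈ S, s.Nonempty := by
      rintro _ ⟨x, hx, rfl⟩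
      exact ⟨x, mem_connectedComponentIn hx⟩
    have hSc : S.Countable := hSd.countable_of_isOpen hSo hSn
    have hU' : U = ⋃ s ∈ S, s := by
      ext x
      simp only [Set.mem_iUnion, S, Set.mem_image, exists_prop]
      constructor
      · exact fun hx => ⟨_, ⟨x, hx, rfl⟩, mem_connectedComponentIn hx⟩
      · rintro ⟨_, ⟨y, -, rfl⟩, hx⟩
        exact connectedComponentIn_subset _ _ hx
    calc volume (F '' U) = volume (⋃ s ∈ S, F '' s) := by
          conv_lhs => rw [hU', Set.image_iUnion₂]
      _ ≤ ∑' s : S, volume (F '' s) := measure_biUnion_le _ hSc _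
      _ ≤ ∑' s : S, ∫⁻ t in s, ‖g t‖ₑ := by
          refine ENNReal.tsum_le_tsum fun s => hconn _ ?_
          obtain ⟨_, ⟨x, -, rfl⟩⟩ := s
          exact isPreconnected_connectedComponentIn.ordConnected
      _ = ∫⁻ t in ⋃ s ∈ S, s, ‖g t‖ₑ :=
          (lintegral_biUnion hSc (fun s hs => (hSo s hs).measurableSet) hSd _).symm
      _ = ∫⁻ t in U, ‖g t‖ₑ := by rw [← hU']
  -- The finite measure `|g| dt` is outer regular, so `A` can be enclosed in an open set at
  -- arbitrarily small cost.
  let ν : Measure ℝ := volume.withDensity fun t => ‖g t‖ₑ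
  have hν : ∀ B : Set ℝ, MeasurableSet B → ν B = ∫⁻ t in B, ‖g t‖ₑ :=
    fun B hB => withDensity_apply _ hB
  have : IsFiniteMeasure ν := isFiniteMeasure_withDensity hg.hasFiniteIntegral.ne
  rw [← hν A hA]
  refine ENNReal.le_of_forall_pos_le_add fun ε hε _ => ?_
  obtain ⟨U, hAU, hU, hle⟩ := A.exists_isOpen_le_add ν (ε := ε) (by exact_mod_cast hε.ne')
  calc volume (F '' A) ≤ volume (F '' U) := measure_mono (Set.image_mono hAU)
    _ ≤ ν U := by rw [hν U hU.measurableSet]; exact hopen U hU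
    _ ≤ ν A + ε := hle

/-- The primitive of a smooth function of integral zero supported in an interval is a smooth
function supported in the same interval. -/
theorem exists_primitive_of_integral_eq_zero {h : ℝ → ℝ} {a b : ℝ} (hh : ContDiff ℝ ∞ h)
    (hs : tsupport h ⊆ Set.Icc a b) (hI : ∫ t, h t = 0) :
    ∃ φ : ℝ → ℝ, ContDiff ℝ ∞ φ ∧ tsupport φ ⊆ Set.Icc a b ∧ deriv φ = h := by
  have hc : Continuous h := hh.continuous
  have h0 : ∀ t, t ∉ Set.Icc a b → h t = 0 := fun t ht =>
    image_eq_zero_of_notMem_tsupport fun h' => ht (hs h')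
  have hint : Integrable h := hc.integrable_of_hasCompactSupport
    (isCompact_Icc.of_isClosed_subset (isClosed_tsupport h) hs)
  have hd : ∀ t, HasDerivAt (fun t => ∫ u in Set.Iic t, h u) (h t) t := by
    intro t
    have h1 : (fun t => ∫ u in Set.Iic t, h u) =
        fun t => (∫ u in (0 : ℝ)..t, h u) + ∫ u in Set.Iic 0, h u := by
      ext t
      rw [← intervalIntegral.integral_Iic_sub_Iic hint.integrableOn hint.integrableOn]
      ring
    rw [h1]
    exact (intervalIntegral.integral_hasDerivAt_right (hc.intervalIntegrable _ _)
      (hc.stronglyMeasurableAtFilter _ _) hc.continuousAt).add_const _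
  have hderiv : deriv (fun t => ∫ u in Set.Iic t, h u) = h := funext fun t => (hd t).deriv
  refine ⟨fun t => ∫ u in Set.Iic t, h u, ?_, ?_, hderiv⟩
  · rw [contDiff_infty_iff_deriv, hderiv]
    exact ⟨fun t => (hd t).differentiableAt, hh⟩
  · refine closure_minimal (fun t ht => ?_) isClosed_Icc
    by_contra hcon
    refine ht ?_
    rw [Set.mem_Icc, not_and_or, not_le, not_le] at hcon
    rcases hcon with hcon | hcon
    · refine setIntegral_eq_zero_of_forall_eq_zero fun u hu => h0 u fun hu' => ?_
      exact absurd (hu'.1.trans hu) (not_le.2 hcon)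
    · change ∫ u in Set.Iic t, h u = 0
      rw [setIntegral_eq_integral_of_forall_compl_eq_zero, hI]
      exact fun u hu => h0 u fun hu' => hu (hu'.2.trans hcon.le)

/-- A continuous function whose weak derivative vanishes on an interval is constant there. -/
theorem eqOn_const_of_integral_mul_deriv_eq_zero {K : ℝ → ℝ} {L : ℝ} (hL : 0 < L)
    (hK : Continuous K)
    (h : ∀ φ : ℝ → ℝ, ContDiff ℝ ∞ φ → HasCompactSupport φ → tsupport φ ⊆ Set.Ioo 0 L →
      ∫ t in Set.Ioo 0 L, K t * deriv φ t = 0) :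
    ∃ c, ∀ t ∈ Set.Icc 0 L, K t = c := by
  -- The du Bois-Reymond argument: for a fixed bump `η` of integral one, any test function `ψ` of
  -- integral `m` differs from `m η` by the derivative of a test function, and the constant is `∫ K
  -- η`.
  let b : ContDiffBump (L / 2) := ⟨L / 4, L / 3, by linarith, by linarith⟩
  have hηI : ∫ t, b.normed volume t = 1 := b.integral_normed
  have hηs : tsupport (b.normed volume) ⊆ Set.Ioo 0 L := by
    rw [b.tsupport_normed_eq, Real.closedBall_eq_Icc]
    intro t ht
    constructor
    · linarith [ht.1, show b.rOut = L / 3 from rfl]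
    · linarith [ht.2, show b.rOut = L / 3 from rfl]
  have hηd : ContDiff ℝ ∞ (b.normed volume) := b.contDiff_normed
  have hηc : HasCompactSupport (b.normed volume) := b.hasCompactSupport_normed
  generalize b.normed volume = η at *
  set c := ∫ t, K t * η t with hc
  have hset : ∀ (k ψ : ℝ → ℝ), tsupport ψ ⊆ Set.Ioo 0 L →
      ∫ t in Set.Ioo 0 L, k t * ψ t = ∫ t, k t * ψ t := by
    intro k ψ hψ
    refine setIntegral_eq_integral_of_forall_compl_eq_zero fun t ht => ?_
    rw [image_eq_zero_of_notMem_tsupport fun h' => ht (hψ h'), mul_zero]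
  have key : ∀ ψ : ℝ → ℝ, ContDiff ℝ ∞ ψ → HasCompactSupport ψ → tsupport ψ ⊆ Set.Ioo 0 L →
      ∫ t, ψ t • (K t - c) = 0 := by
    intro ψ hψd hψc hψs
    set m := ∫ t, ψ t with hm
    have iψ : Integrable ψ := hψd.continuous.integrable_of_hasCompactSupport hψc
    have iη : Integrable η := hηd.continuous.integrable_of_hasCompactSupport hηc
    have iKψ : Integrable fun t => K t * ψ t :=
      (hK.mul hψd.continuous).integrable_of_hasCompactSupport hψc.mul_left
    have iKη : Integrable fun t => K t * η t :=
      (hK.mul hηd.continuous).integrable_of_hasCompactSupport hηc.mul_left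
    -- The extreme points of this compact nonempty set bound a closed interval inside `(0, L)`,
    -- which keeps the primitive compactly supported there.
    have hne : (tsupport ψ ∪ tsupport η).Nonempty := by
      by_contra hcon
      rw [Set.not_nonempty_iff_eq_empty, Set.union_empty_iff] at hcon
      rw [tsupport_eq_empty_iff.1 hcon.2] at hηI
      simp at hηI
    have hcomp : IsCompact (tsupport ψ ∪ tsupport η) :=
      IsCompact.union hψc hηc
    have hsub : tsupport ψ ∪ tsupport η ⊆ Set.Ioo 0 L := Set.union_subset hψs hηs
    have ha := hsub (hcomp.sInf_mem hne)
    have hb := hsub (hcomp.sSup_mem hne)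
    have hI : ∫ t, (ψ t - m * η t) = 0 := by
      rw [integral_sub iψ (iη.const_mul m), integral_const_mul, hηI]
      simp [hm]
    have hs : tsupport (fun t => ψ t - m * η t) ⊆
        Set.Icc (sInf (tsupport ψ ∪ tsupport η)) (sSup (tsupport ψ ∪ tsupport η)) := by
      refine closure_minimal (fun t ht => ?_) isClosed_Icc
      have ht' : t ∈ tsupport ψ ∪ tsupport η := by
        by_contra hcon
        rw [Set.mem_union, not_or] at hcon
        refine ht ?_
        simp [image_eq_zero_of_notMem_tsupport hcon.1, image_eq_zero_of_notMem_tsupport hcon.2]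
      exact ⟨csInf_le hcomp.bddBelow ht', le_csSup hcomp.bddAbove ht'⟩
    obtain ⟨φ, hφd, hφs, hφ⟩ := exists_primitive_of_integral_eq_zero
      (hψd.sub (contDiff_const.mul hηd)) hs hI
    have hφs' : tsupport φ ⊆ Set.Ioo 0 L :=
      hφs.trans fun t ht => ⟨ha.1.trans_le ht.1, ht.2.trans_lt hb.2⟩
    have h1 := h φ hφd (isCompact_Icc.of_isClosed_subset (isClosed_tsupport φ) hφs) hφs'
    rw [hφ, hset K _ (hs.trans fun t ht => ⟨ha.1.trans_le ht.1, ht.2.trans_lt hb.2⟩)] at h1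
    have h2 : ∫ t, K t * (ψ t - m * η t) = (∫ t, K t * ψ t) - m * c := by
      rw [hc, ← integral_const_mul, ← integral_sub iKψ (iKη.const_mul m)]
      congr 1
      ext t
      ring
    have h3 : ∫ t, ψ t • (K t - c) = (∫ t, K t * ψ t) - m * c := by
      rw [hm, ← integral_mul_const, ← integral_sub iKψ (iψ.mul_const c)]
      congr 1
      ext t
      simp only [smul_eq_mul]
      ring
    rw [h3, ← h2, h1]
  have hcont : Continuous fun t => K t - c := hK.sub continuous_const
  have hae := isOpen_Ioo.ae_eq_zero_of_integral_contDiff_smul_eq_zero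
    (hcont.locallyIntegrable.locallyIntegrableOn (Set.Ioo 0 L)) (μ := volume) key
  refine ⟨c, fun t ht => ?_⟩
  have h4 : Set.EqOn (fun t => K t - c) (fun _ => 0) (Set.Ioo 0 L) := by
    refine Measure.eqOn_open_of_ae_eq (μ := volume) ?_ isOpen_Ioo hcont.continuousOn
      continuousOn_const
    exact (ae_restrict_iff' measurableSet_Ioo).2 hae
  have h5 := h4.closure hcont continuous_const
  rw [closure_Ioo hL.ne] at h5
  exact sub_eq_zero.1 (h5 ht)

/-- A continuous function on an interval with an integrable weak derivative is a primitive of its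
weak derivative. -/
theorem sub_eq_intervalIntegral_of_weak_deriv {F g : ℝ → ℝ} {L : ℝ} (hL : 0 < L)
    (hF : Continuous F) (hg : Integrable g)
    (h : ∀ φ : ℝ → ℝ, ContDiff ℝ ∞ φ → HasCompactSupport φ → tsupport φ ⊆ Set.Ioo 0 L →
      ∫ t in Set.Ioo 0 L, F t * deriv φ t = -∫ t in Set.Ioo 0 L, g t * φ t)
    {s t : ℝ} (hs : s ∈ Set.Icc 0 L) (ht : t ∈ Set.Icc 0 L) :
    F t - F s = ∫ u in s..t, g u := by
  have hgi : ∀ a b, IntervalIntegrable g volume a b := fun a b => hg.intervalIntegrable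
  have hIc : Continuous fun t => ∫ u in (0 : ℝ)..t, g u :=
    intervalIntegral.continuous_primitive hgi 0
  -- The difference of `F` and the primitive of `g` has zero weak derivative, by integration by
  -- parts for absolutely continuous functions.
  obtain ⟨c, hc⟩ := eqOn_const_of_integral_mul_deriv_eq_zero
    (K := fun t => F t - ∫ u in (0 : ℝ)..t, g u) hL (hF.sub hIc) (by
      intro φ hφd hφc hφs
      have hφ0 : φ 0 = 0 :=
        image_eq_zero_of_notMem_tsupport fun h' => lt_irrefl _ (hφs h').1
      have hφL : φ L = 0 :=
        image_eq_zero_of_notMem_tsupport fun h' => lt_irrefl _ (hφs h').2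
      have hd : Continuous (deriv φ) := hφd.continuous_deriv (by norm_num)
      have hac := (hgi 0 L).absolutelyContinuousOnInterval_intervalIntegral
        (c := 0) (by simp [hL.le])
      have hφac : AbsolutelyContinuousOnInterval φ 0 L :=
        ContDiffOn.absolutelyContinuousOnInterval
          ((hφd.of_le (by norm_num)).contDiffOn)
      have hparts := hac.integral_mul_deriv_eq_deriv_mul hφac
      rw [hφ0, hφL, mul_zero, mul_zero, sub_zero, zero_sub] at hparts
      have hde : ∫ x in (0 : ℝ)..L, deriv (fun t => ∫ u in (0 : ℝ)..t, g u) x * φ x =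
          ∫ x in (0 : ℝ)..L, g x * φ x := by
        refine intervalIntegral.integral_congr_ae ?_
        filter_upwards [(hgi 0 L).ae_hasDerivAt_integral] with x hx hxm
        rw [(hx (Set.uIoc_subset_uIcc hxm) 0 (by simp [hL.le])).deriv]
      rw [hde, intervalIntegral.integral_of_le hL.le, intervalIntegral.integral_of_le hL.le,
        integral_Ioc_eq_integral_Ioo, integral_Ioc_eq_integral_Ioo] at hparts
      have e1 : Integrable fun t => F t * deriv φ t :=
        (hF.mul hd).integrable_of_hasCompactSupport hφc.deriv.mul_left
      have e2 : Integrable fun t => (∫ u in (0 : ℝ)..t, g u) * deriv φ t :=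
        (hIc.mul hd).integrable_of_hasCompactSupport hφc.deriv.mul_left
      simp_rw [sub_mul]
      rw [integral_sub e1.integrableOn e2.integrableOn, hparts, h φ hφd hφc hφs, sub_self])
  have h1 := hc t ht
  have h2 := hc s hs
  have h3 := intervalIntegral.integral_interval_sub_left (hgi 0 t) (hgi 0 s)
  linarith

/-! ### Entropy of a function with bounded oscillation -/

/-- The left side vanishes to second order at `s = 1`. For `0 < s ≤ 2`, `log s ≤ s - 1` bounds it by
`(2 s + 1) (s - 1)²`; elsewhere `s² ≤ 4 (s - 1)²`, and the logarithm is at most `2 log M`. -/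
theorem Real.sq_mul_log_sq_le {s M : ℝ} (hM : 1 ≤ M) (hs : |s| ≤ M) :
    s ^ 2 * Real.log (s ^ 2) - s ^ 2 + 1 ≤ (5 + 8 * Real.log M) * (s - 1) ^ 2 := by
  have hlM : 0 ≤ Real.log M := Real.log_nonneg hM
  have hlog : Real.log (s ^ 2) ≤ 2 * Real.log M := by
    rcases eq_or_ne s 0 with rfl | h0
    · simpa using hlM
    · rw [← sq_abs, Real.log_pow]
      have := Real.log_le_log (abs_pos.2 h0) hs
      push_cast
      linarith
  rcases le_or_gt s 0 with h | h
  · have h1 : s ^ 2 * Real.log (s ^ 2) ≤ s ^ 2 * (2 * Real.log M) :=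
      mul_le_mul_of_nonneg_left hlog (sq_nonneg s)
    nlinarith [mul_nonneg hlM (neg_nonneg.2 h), mul_nonneg hlM (sq_nonneg s), sq_nonneg s]
  · rcases le_or_gt s 2 with h2 | h2
    · have h3 : Real.log (s ^ 2) ≤ 2 * (s - 1) := by
        rw [Real.log_pow]
        have := Real.log_le_sub_one_of_pos h
        push_cast
        linarith
      have h4 := mul_le_mul_of_nonneg_left h3 (sq_nonneg s)
      have h5 : (2 * s + 1) * (s - 1) ^ 2 ≤ 5 * (s - 1) ^ 2 :=
        mul_le_mul_of_nonneg_right (by linarith) (sq_nonneg _)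
      nlinarith [mul_nonneg hlM (sq_nonneg (s - 1))]
    · have h1 : s ^ 2 * Real.log (s ^ 2) ≤ s ^ 2 * (2 * Real.log M) :=
        mul_le_mul_of_nonneg_left hlog (sq_nonneg s)
      have h4 : s ^ 2 ≤ 4 * (s - 1) ^ 2 := by nlinarith
      have h5 := mul_le_mul_of_nonneg_left h4 hlM
      nlinarith [sq_nonneg (s - 1)]

namespace MeasureTheory

variable {X : Type*} [MeasurableSpace X] {μ : Measure X} [IsProbabilityMeasure μ]

/-- Bounds on the variance and on the oscillation of a normalized function with nonnegative mean
bound its entropy. -/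
theorem integral_sq_mul_log_sq_le_of_normalized {s : X → ℝ} (hs : AEStronglyMeasurable s μ)
    {B : ℝ} (hB : ∀ x, |s x| ≤ B) (h1 : ∫ x, s x ^ 2 ∂μ = 1) (hm : 0 ≤ ∫ x, s x ∂μ)
    {c P R T : ℝ} (hP : 1 ≤ P) (hR : 1 ≤ R) (hT : 0 ≤ T)
    (hvar : ∫ x, (s x - c) ^ 2 ∂μ ≤ P * T) (hosc : ∀ x y, (s x - s y) ^ 2 ≤ R * T) :
    ∫ x, s x ^ 2 * Real.log (s x ^ 2) ∂μ ≤ (18 + 8 * Real.log (2 * R)) * P * T := by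
  have hi : Integrable s μ := Integrable.of_bound hs B (ae_of_all _ hB)
  have hi2 : Integrable (fun x => s x ^ 2) μ := by
    refine Integrable.of_bound (hs.pow 2) (B ^ 2) (ae_of_all _ fun x => ?_)
    rw [norm_pow, Real.norm_eq_abs]
    exact pow_le_pow_left₀ (abs_nonneg _) (hB x) 2
  have hquad : ∀ a : ℝ, ∫ x, (s x - a) ^ 2 ∂μ = 1 - 2 * a * (∫ x, s x ∂μ) + a ^ 2 := by
    intro a
    have : (fun x => (s x - a) ^ 2) = fun x => s x ^ 2 - 2 * a * s x + a ^ 2 := by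
      ext x; ring
    have hsub : Integrable (fun x => s x ^ 2 - 2 * a * s x) μ := hi2.sub (hi.const_mul _)
    rw [this, integral_add hsub (integrable_const _),
      integral_sub hi2 (hi.const_mul _), integral_const_mul, h1]
    simp
  set m := ∫ x, s x ∂μ with hmdef
  have hq1 := hquad 1
  rw [hquad c] at hvar
  -- Since `0 ≤ m ≤ 1`, `2 (1 - m) ≤ 2 (1 - m²)`, which is twice the variance, and the variance is
  -- at most the mean square deviation from any `c`.
  have hvP : ∫ x, (s x - 1) ^ 2 ∂μ ≤ 2 * (P * T) := by
    have hm1 : m ^ 2 ≤ 1 := by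
      have h := hquad m
      have h' : 0 ≤ ∫ x, (s x - m) ^ 2 ∂μ := integral_nonneg fun x => sq_nonneg _
      nlinarith
    have hm1' : m ≤ 1 := by nlinarith
    rw [hq1]
    nlinarith [sq_nonneg (m - c)]
  have hv2 : ∫ x, (s x - 1) ^ 2 ∂μ ≤ 2 := by rw [hq1]; linarith
  have hv0 : 0 ≤ ∫ x, (s x - 1) ^ 2 ∂μ := integral_nonneg fun x => sq_nonneg _
  -- As `s²` has mean one, `|s| ≤ 1` somewhere; the oscillation then bounds `|s|` everywhere.
  obtain ⟨y, hy⟩ := exists_le_integral hi2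
  rw [h1] at hy
  have hy' : |s y| ≤ 1 := by
    rw [← sq_abs] at hy
    nlinarith [abs_nonneg (s y)]
  set q := Real.sqrt (R * T) with hq
  have hq0 : 0 ≤ q := Real.sqrt_nonneg _
  have hqs : q ^ 2 = R * T := Real.sq_sqrt (by positivity)
  have hbound : ∀ x, |s x| ≤ 1 + q := by
    intro x
    have h2 : |s x - s y| ≤ q := Real.abs_le_sqrt (hosc x y)
    have h3 := abs_sub_abs_le_abs_sub (s x) (s y)
    linarith
  have hlog : 2 * Real.log (1 + q) ≤ Real.log (2 * R) + T := by
    have h2 : 2 * Real.log (1 + q) = Real.log ((1 + q) ^ 2) := by rw [Real.log_pow]; norm_num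
    have h3 : (1 + q) ^ 2 ≤ 2 * R * (1 + T) := by nlinarith [sq_nonneg (1 - q)]
    rw [h2]
    refine (Real.log_le_log (by positivity) h3).trans ?_
    rw [Real.log_mul (by positivity) (by positivity)]
    linarith [Real.log_le_sub_one_of_pos (show 0 < 1 + T by positivity)]
  have hpt : ∀ x, s x ^ 2 * Real.log (s x ^ 2) ≤
      (5 + 8 * Real.log (1 + q)) * (s x - 1) ^ 2 + (s x ^ 2 - 1) := fun x => by
    linarith [Real.sq_mul_log_sq_le (by linarith) (hbound x)]
  have hi3 : Integrable (fun x => (s x - 1) ^ 2) μ := by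
    have : (fun x => (s x - 1) ^ 2) = fun x => s x ^ 2 - 2 * s x + 1 := by
      ext x; ring
    rw [this]
    exact (hi2.sub (hi.const_mul _)).add (integrable_const _)
  have hl0 : 0 ≤ Real.log (2 * R) := Real.log_nonneg (by linarith)
  have hlM : 0 ≤ Real.log (1 + q) := Real.log_nonneg (by linarith)
  have hPT : T ≤ P * T := le_mul_of_one_le_left hT hP
  have hrhs : 0 ≤ (18 + 8 * Real.log (2 * R)) * P * T := by positivity
  -- Without integrability the integral is `0` by convention, and the right side is nonnegative.
  by_cases hint : Integrable (fun x => s x ^ 2 * Real.log (s x ^ 2)) μ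
  · calc ∫ x, s x ^ 2 * Real.log (s x ^ 2) ∂μ
        ≤ ∫ x, ((5 + 8 * Real.log (1 + q)) * (s x - 1) ^ 2 + (s x ^ 2 - 1)) ∂μ :=
          integral_mono hint ((hi3.const_mul _).add (hi2.sub (integrable_const _))) hpt
      _ = (5 + 8 * Real.log (1 + q)) * ∫ x, (s x - 1) ^ 2 ∂μ := by
          have hsub : Integrable (fun x => s x ^ 2 - 1) μ := hi2.sub (integrable_const _)
          rw [integral_add (hi3.const_mul _) hsub,
            integral_sub hi2 (integrable_const _), h1, integral_const_mul]
          simp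
      _ ≤ (5 + 4 * (Real.log (2 * R) + T)) * ∫ x, (s x - 1) ^ 2 ∂μ :=
          mul_le_mul_of_nonneg_right (by linarith) hv0
      -- The term `log (2R)` is paired with the bound `2PT` on the deviation, but the extra `T` with
      -- the bound `2`, so the result stays linear in `T`.
      _ ≤ (18 + 8 * Real.log (2 * R)) * P * T := by
          have e1 := mul_le_mul_of_nonneg_left hvP (show 0 ≤ 5 + 4 * Real.log (2 * R) by positivity)
          have e2 := mul_le_mul_of_nonneg_left hv2 (show 0 ≤ 4 * T by positivity)
          nlinarith
  · rw [integral_undef hint]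
    exact hrhs

/-- Bounds on the variance and on the oscillation of a bounded function bound its entropy. -/
theorem integral_sq_mul_log_div_le {F : X → ℝ} (hF : AEStronglyMeasurable F μ)
    {B : ℝ} (hB : ∀ x, |F x| ≤ B) {c P R T : ℝ} (hP : 1 ≤ P) (hR : 1 ≤ R) (hT : 0 ≤ T)
    (hvar : ∫ x, (F x - c) ^ 2 ∂μ ≤ P * T) (hosc : ∀ x y, (F x - F y) ^ 2 ≤ R * T) :
    ∫ x, F x ^ 2 * Real.log (F x ^ 2 / ∫ y, F y ^ 2 ∂μ) ∂μ ≤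
      (18 + 8 * Real.log (2 * R)) * P * T := by
  have hl0 : 0 ≤ Real.log (2 * R) := Real.log_nonneg (by linarith)
  -- When the norm is zero, division by zero and `log 0 = 0` make the integrand vanish.
  rcases (integral_nonneg fun x => sq_nonneg (F x) : 0 ≤ ∫ y, F y ^ 2 ∂μ).eq_or_lt with h0 | h0
  · rw [← h0]
    simp only [div_zero, Real.log_zero, mul_zero, integral_zero]
    positivity
  set N := ∫ y, F y ^ 2 ∂μ with hN
  -- Normalization by `± N^{-1/2}`, the sign making the mean nonnegative.
  obtain ⟨a, ha, ham⟩ : ∃ a : ℝ, a ^ 2 = N⁻¹ ∧ 0 ≤ a * ∫ x, F x ∂μ := by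
    have hsq : Real.sqrt N⁻¹ ^ 2 = N⁻¹ := Real.sq_sqrt (by positivity)
    rcases le_total 0 (∫ x, F x ∂μ) with h | h
    · exact ⟨Real.sqrt N⁻¹, hsq, mul_nonneg (Real.sqrt_nonneg _) h⟩
    · exact ⟨-Real.sqrt N⁻¹, by rw [neg_sq, hsq],
        mul_nonneg_of_nonpos_of_nonpos (neg_nonpos.2 (Real.sqrt_nonneg _)) h⟩
  have hsc : ∀ u : ℝ, (a * u) ^ 2 = N⁻¹ * u ^ 2 := fun u => by rw [mul_pow, ha]
  have key := integral_sq_mul_log_sq_le_of_normalized (μ := μ) (s := fun x => a * F x)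
    (hF.const_mul a) (B := |a| * B)
    (fun x => by rw [abs_mul]; exact mul_le_mul_of_nonneg_left (hB x) (abs_nonneg a))
    (by simp_rw [hsc]; rw [integral_const_mul, ← hN, inv_mul_cancel₀ h0.ne'])
    (by rw [integral_const_mul]; exact ham) (c := a * c) (T := N⁻¹ * T) hP hR (by positivity)
    (by
      simp_rw [← mul_sub, hsc]
      rw [integral_const_mul, mul_left_comm]
      exact mul_le_mul_of_nonneg_left hvar (by positivity))
    (fun x y => by
      rw [← mul_sub, hsc, mul_left_comm]
      exact mul_le_mul_of_nonneg_left (hosc x y) (by positivity))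
  have heq : ∫ x, (a * F x) ^ 2 * Real.log ((a * F x) ^ 2) ∂μ =
      N⁻¹ * ∫ x, F x ^ 2 * Real.log (F x ^ 2 / N) ∂μ := by
    rw [← integral_const_mul]
    congr 1
    ext x
    rw [hsc, mul_assoc, mul_comm N⁻¹ (F x ^ 2), div_eq_mul_inv]
  rw [heq, mul_left_comm] at key
  exact le_of_mul_le_mul_left key (by positivity)

end MeasureTheory

/-- Cauchy-Schwarz against the constant `1`, read off the discriminant of the nonnegative quadratic
`a ↦ ∫ (h - a)²`. -/
theorem MeasureTheory.sq_integral_le_measureReal_mul {X : Type*} [MeasurableSpace X]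
    {μ : Measure X} [IsFiniteMeasure μ] {h : X → ℝ} (hh : MemLp h 2 μ) :
    (∫ x, h x ∂μ) ^ 2 ≤ μ.real Set.univ * ∫ x, h x ^ 2 ∂μ := by
  have hi : Integrable h μ := hh.integrable one_le_two
  have hi2 : Integrable (fun x => h x ^ 2) μ := hh.integrable_sq
  have key : ∀ a : ℝ, 0 ≤ μ.real Set.univ * (a * a) + (-2 * ∫ x, h x ∂μ) * a +
      ∫ x, h x ^ 2 ∂μ := by
    intro a
    have h1 : 0 ≤ ∫ x, (h x - a) ^ 2 ∂μ := integral_nonneg fun x => sq_nonneg _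
    have h2 : (fun x => (h x - a) ^ 2) = fun x => h x ^ 2 - 2 * a * h x + a ^ 2 := by
      ext x; ring
    have h3 : Integrable (fun x => h x ^ 2 - 2 * a * h x) μ := hi2.sub (hi.const_mul _)
    rw [h2, integral_add h3 (integrable_const _), integral_sub hi2 (hi.const_mul _),
      integral_const_mul, integral_const, smul_eq_mul] at h1
    linarith
  have := discrim_le_zero key
  rw [discrim] at this
  linarith

/-! ### The topology of the quantum graph -/

namespace WeightedGraph

variable {V : Type*} (G : WeightedGraph V)

theorem adj_src_tgt (e : G.graph.edgeSet) : G.graph.Adj (G.src e) (G.tgt e) := by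
  rw [← SimpleGraph.mem_edgeSet]
  have h : s(G.src e, G.tgt e) = e.1 := Quot.out_eq e.1
  rw [h]
  exact e.2

theorem len_pos (e : G.graph.edgeSet) : 0 < G.len e :=
  G.weight_pos _ _ (G.adj_src_tgt e)

theorem param_of_nonpos {e : G.graph.edgeSet} {t : ℝ} (ht : t ≤ 0) :
    G.param e t = Point.vertex (G.src e) := by
  rw [param, dif_neg ht.not_gt]

theorem param_of_len_le {e : G.graph.edgeSet} {t : ℝ} (ht : G.len e ≤ t) :
    G.param e t = Point.vertex (G.tgt e) := by
  rw [param, dif_pos ((G.len_pos e).trans_le ht), dif_neg ht.not_gt]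

theorem param_of_mem_Ioo {e : G.graph.edgeSet} {t : ℝ} (ht : t ∈ Set.Ioo 0 (G.len e)) :
    G.param e t = Point.inner e t ht := by
  rw [param, dif_pos ht.1, dif_pos ht.2]

theorem continuous_param (e : G.graph.edgeSet) : Continuous (G.param e) :=
  continuous_iSup_rng (i := e) continuous_coinduced_rng

theorem measurable_param (e : G.graph.edgeSet) : Measurable (G.param e) :=
  (G.continuous_param e).measurable

theorem continuous_of_comp_param {Z : Type*} [TopologicalSpace Z] {f : G.Point → Z}
    (h : ∀ e, Continuous fun t => f (G.param e t)) : Continuous f :=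
  continuous_iSup_dom.2 fun e => continuous_coinduced_dom.2 (h e)

theorem exists_edge_of_adj {v w : V} (h : G.graph.Adj v w) :
    ∃ e, (G.src e = v ∧ G.tgt e = w) ∨ (G.src e = w ∧ G.tgt e = v) := by
  refine ⟨⟨s(v, w), h⟩, ?_⟩
  have h' : s(G.src ⟨s(v, w), h⟩, G.tgt ⟨s(v, w), h⟩) = s(v, w) := Quot.out_eq s(v, w)
  simpa using h'

theorem exists_param_eq [Nontrivial V] (x : G.Point) :
    ∃ e, ∃ t ∈ Set.Icc 0 (G.len e), G.param e t = x := by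
  cases x with
  | vertex v =>
    obtain ⟨w, hw⟩ := G.connected.preconnected.exists_adj_of_nontrivial v
    obtain ⟨e, ⟨rfl, -⟩ | ⟨-, rfl⟩⟩ := G.exists_edge_of_adj hw
    · exact ⟨e, 0, ⟨le_rfl, (G.len_pos e).le⟩, G.param_of_nonpos le_rfl⟩
    · exact ⟨e, G.len e, ⟨(G.len_pos e).le, le_rfl⟩, G.param_of_len_le le_rfl⟩
  | inner e t ht => exact ⟨e, t, Set.Ioo_subset_Icc_self ht, G.param_of_mem_Ioo ht⟩

theorem nonempty_edgeSet [Nontrivial V] : Nonempty G.graph.edgeSet := by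
  obtain ⟨v, -, -⟩ := exists_pair_ne V
  exact ⟨(G.exists_param_eq (Point.vertex v)).choose⟩

theorem finite_edgeSet [Finite V] : Finite G.graph.edgeSet := by
  have : Finite (Sym2 V) := Quot.finite _
  infer_instance

theorem compactSpace_point [Finite V] [Nontrivial V] : CompactSpace G.Point := by
  have := G.finite_edgeSet
  refine ⟨?_⟩
  have h : Set.univ = ⋃ e, G.param e '' Set.Icc 0 (G.len e) := by
    refine (Set.eq_univ_of_forall fun x => ?_).symm
    obtain ⟨e, t, ht, hx⟩ := G.exists_param_eq x
    exact Set.mem_iUnion.2 ⟨e, t, ht, hx⟩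
  rw [h]
  exact isCompact_iUnion fun e => isCompact_Icc.image (G.continuous_param e)

theorem joined_param (e : G.graph.edgeSet) (s t : ℝ) : Joined (G.param e s) (G.param e t) :=
  (PathConnectedSpace.joined s t).map (G.continuous_param e)

theorem joined_vertex {v w : V} (p : G.graph.Walk v w) :
    Joined (Point.vertex v : G.Point) (Point.vertex w) := by
  induction p with
  | nil => exact Joined.refl _
  | cons h p ih =>
    refine Joined.trans ?_ ih
    obtain ⟨e, ⟨rfl, rfl⟩ | ⟨rfl, rfl⟩⟩ := G.exists_edge_of_adj h
    all_goals
      have := G.joined_param e 0 (G.len e)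
      rw [G.param_of_nonpos le_rfl, G.param_of_len_le le_rfl] at this
    · exact this
    · exact this.symm

/-- Makes the infimum over paths in `elevation` range over a nonempty set. -/
theorem joined [Nontrivial V] (x y : G.Point) : Joined x y := by
  have h : ∀ x : G.Point, ∃ v, Joined x (Point.vertex v) := by
    intro x
    obtain ⟨e, t, -, rfl⟩ := G.exists_param_eq x
    have := G.joined_param e t 0
    rw [G.param_of_nonpos le_rfl] at this
    exact ⟨_, this⟩
  obtain ⟨v, hv⟩ := h x
  obtain ⟨w, hw⟩ := h y
  obtain ⟨p⟩ := G.connected.preconnected v w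
  exact (hv.trans (G.joined_vertex p)).trans hw.symm

/-! ### The distance and the energy -/

theorem walkLength_nonneg {i j : V} (p : G.graph.Walk i j) : 0 ≤ G.walkLength p := by
  refine List.sum_nonneg fun a ha => ?_
  obtain ⟨d, -, rfl⟩ := List.mem_map.1 ha
  exact (G.weight_pos _ _ d.adj).le

theorem bddBelow_walkLength (i j : V) :
    BddBelow (Set.range fun p : G.graph.Walk i j => G.walkLength p) :=
  ⟨0, by rintro _ ⟨p, rfl⟩; exact G.walkLength_nonneg p⟩

theorem vertexDist_le_weight_add {i j : V} (h : G.graph.Adj i j) (y : V) :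
    G.vertexDist i y ≤ G.weight i j + G.vertexDist j y := by
  have : Nonempty (G.graph.Walk j y) := G.connected.preconnected j y
  rw [← sub_le_iff_le_add']
  refine le_ciInf fun p => ?_
  rw [sub_le_iff_le_add']
  have h1 : G.walkLength (SimpleGraph.Walk.cons h p) = G.weight i j + G.walkLength p := by
    simp [walkLength]
  rw [← h1]
  exact ciInf_le (G.bddBelow_walkLength i y) _

/-- The distances to `y` from the two ends of an edge differ by at most its length, so the formula
for interior points is also right at the ends. This one expression, continuous in `t`, covers the
whole line. -/
theorem distTo_param (y : V) (e : G.graph.edgeSet) (t : ℝ) :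
    G.distTo y (G.param e t) =
      min (max 0 (min t (G.len e)) + G.vertexDist (G.src e) y)
        (G.len e - max 0 (min t (G.len e)) + G.vertexDist (G.tgt e) y) := by
  have hadj := G.adj_src_tgt e
  have hlen := G.len_pos e
  have h1 : G.vertexDist (G.src e) y ≤ G.len e + G.vertexDist (G.tgt e) y :=
    G.vertexDist_le_weight_add hadj y
  have h2 : G.vertexDist (G.tgt e) y ≤ G.len e + G.vertexDist (G.src e) y := by
    have := G.vertexDist_le_weight_add hadj.symm y
    rwa [← G.weight_symm _ _ hadj] at this
  rcases le_or_gt t 0 with h | h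
  · rw [G.param_of_nonpos h, max_eq_left ((min_le_left _ _).trans h), zero_add, sub_zero,
      min_eq_left h1]
    rfl
  · rcases le_or_gt (G.len e) t with h' | h'
    · rw [G.param_of_len_le h', min_eq_right h', max_eq_right hlen.le, sub_self, zero_add,
        min_eq_right h2]
      rfl
    · rw [G.param_of_mem_Ioo ⟨h, h'⟩, min_eq_left h'.le, max_eq_right h.le]
      rfl

theorem continuous_distTo (y : V) : Continuous (G.distTo y) := by
  refine G.continuous_of_comp_param fun e => ?_
  simp_rw [distTo_param]
  fun_prop

section Energy

variable [Fintype V]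

theorem continuous_energy (ν : V → ℝ) : Continuous (G.energy ν) := by
  unfold energy
  have := G.continuous_distTo
  fun_prop

theorem energy_nonneg {ν : V → ℝ} (hν : ν ∈ stdSimplex ℝ V) (x : G.Point) : 0 ≤ G.energy ν x :=
  mul_nonneg (by norm_num) (Finset.sum_nonneg fun y _ => mul_nonneg (sq_nonneg _) (hν.1 y))

theorem exists_energy_le [Nontrivial V] :
    ∃ B : ℝ, 0 ≤ B ∧ ∀ ν ∈ stdSimplex ℝ V, ∀ x, G.energy ν x ≤ B := by
  have := G.compactSpace_point
  -- The bounds `D y` come from compactness, before `ν` is chosen, and `ν y ≤ 1` makes the final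
  -- bound uniform.
  have h : ∀ y, ∃ D, ∀ x, G.distTo y x ^ 2 ≤ D := fun y => by
    obtain ⟨D, hD⟩ := (isCompact_range ((G.continuous_distTo y).pow 2)).bddAbove
    exact ⟨D, fun x => hD ⟨x, rfl⟩⟩
  choose D hD using h
  obtain ⟨v, -, -⟩ := exists_pair_ne V
  have hD0 : ∀ y, 0 ≤ D y := fun y => (sq_nonneg _).trans (hD y (Point.vertex v))
  refine ⟨∑ y, D y, Finset.sum_nonneg fun y _ => hD0 y, fun ν hν x => ?_⟩
  have h1 : ∀ y, ν y ≤ 1 := fun y => by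
    rw [← hν.2]
    exact Finset.single_le_sum (fun z _ => hν.1 z) (Finset.mem_univ y)
  have h2 : ∑ y, G.distTo y x ^ 2 * ν y ≤ ∑ y, D y :=
    Finset.sum_le_sum fun y _ =>
      (mul_le_of_le_one_right (sq_nonneg _) (h1 y)).trans (hD y x)
  have h3 : 0 ≤ ∑ y, D y := Finset.sum_nonneg fun y _ => hD0 y
  unfold energy
  linarith

end Energy

/-! ### The length measure and the Gibbs measure -/

theorem isFiniteMeasure_lengthMeasure [Finite V] : IsFiniteMeasure G.lengthMeasure := by
  have := G.finite_edgeSet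
  unfold lengthMeasure
  infer_instance

theorem restrict_volume_map_param_le (e : G.graph.edgeSet) :
    (volume.restrict (Set.Icc 0 (G.len e))).map (G.param e) ≤ G.lengthMeasure :=
  Measure.le_sum (fun e : G.graph.edgeSet =>
    (volume.restrict (Set.Icc 0 (G.len e))).map (G.param e)) e

theorem lengthMeasure_ne_zero [Nontrivial V] : G.lengthMeasure ≠ 0 := by
  obtain ⟨e⟩ := G.nonempty_edgeSet
  intro h
  have h2 := G.restrict_volume_map_param_le e Set.univ
  rw [h, Measure.map_apply (G.measurable_param e) MeasurableSet.univ] at h2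
  simp only [Set.preimage_univ, Measure.restrict_apply_univ, Real.volume_Icc, sub_zero,
    Measure.coe_zero, Pi.zero_apply, nonpos_iff_eq_zero, ENNReal.ofReal_eq_zero] at h2
  exact absurd h2 (G.len_pos e).not_ge

theorem lintegral_lengthMeasure {h : G.Point → ENNReal} (hh : AEMeasurable h G.lengthMeasure)
    {K : Set G.Point} (hK : MeasurableSet K) :
    ∫⁻ x in K, h x ∂G.lengthMeasure =
      ∑' e, ∫⁻ t in G.param e ⁻¹' K ∩ Set.Icc 0 (G.len e), h (G.param e t) := by
  rw [lengthMeasure, Measure.restrict_sum _ hK, lintegral_sum_measure]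
  refine tsum_congr fun e => ?_
  have hm := hh.mono_measure (G.restrict_volume_map_param_le e)
  rw [Measure.restrict_map (G.measurable_param e) hK,
    Measure.restrict_restrict (G.measurable_param e hK),
    lintegral_map' _ (G.measurable_param e).aemeasurable]
  rw [← Measure.restrict_restrict (G.measurable_param e hK),
    ← Measure.restrict_map (G.measurable_param e) hK]
  exact hm.restrict

/-! ### Increments along paths -/

theorem param_clamp (e : G.graph.edgeSet) (t : ℝ) :
    G.param e (max 0 (min t (G.len e))) = G.param e t := by
  rcases le_or_gt t 0 with h | h
  · rw [max_eq_left ((min_le_left _ _).trans h), G.param_of_nonpos le_rfl, G.param_of_nonpos h]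
  · rcases le_or_gt (G.len e) t with h' | h'
    · rw [min_eq_right h', max_eq_right (G.len_pos e).le, G.param_of_len_le le_rfl,
        G.param_of_len_le h']
    · rw [min_eq_left h'.le, max_eq_right h.le]

theorem integrableOn_comp_param {g : G.Point → ℝ} (hg : Integrable g G.lengthMeasure)
    (e : G.graph.edgeSet) : IntegrableOn (fun t => g (G.param e t)) (Set.Icc 0 (G.len e)) :=
  (hg.mono_measure (G.restrict_volume_map_param_le e)).comp_aemeasurable
    (G.measurable_param e).aemeasurable

/-- Both sides are unchanged when `s` and `t` are clamped to the edge: `param` is constant outside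
it and the indicator vanishes there. Validity on the whole line is what
`volume_image_le_lintegral_enorm` requires. -/
theorem sub_eq_intervalIntegral_weakGradient {F g : G.Point → ℝ} (hF : Continuous F)
    (hg : Integrable g G.lengthMeasure) (hw : G.IsWeakGradient F g) (e : G.graph.edgeSet)
    (s t : ℝ) :
    F (G.param e t) - F (G.param e s) =
      ∫ u in s..t, (Set.Ioo 0 (G.len e)).indicator (fun u => g (G.param e u)) u := by
  have hlen := G.len_pos e
  have hgi : Integrable ((Set.Ioo 0 (G.len e)).indicator (fun u => g (G.param e u))) :=
    ((G.integrableOn_comp_param hg e).mono_set Set.Ioo_subset_Icc_self).integrable_indicator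
      measurableSet_Ioo
  set k := (Set.Ioo 0 (G.len e)).indicator (fun u => g (G.param e u)) with hk
  have hclamp : ∀ t, max 0 (min t (G.len e)) ∈ Set.Icc 0 (G.len e) := fun t =>
    ⟨le_max_left _ _, max_le hlen.le (min_le_right _ _)⟩
  have hzero : ∀ t, ∫ u in max 0 (min t (G.len e))..t, k u = 0 := by
    intro t
    have h0 : ∀ u ∈ Set.uIoc (max 0 (min t (G.len e))) t, k u = 0 := by
      intro u hu
      refine Set.indicator_of_notMem (fun hu' => ?_) _
      rcases le_or_gt t 0 with h | h
      · rw [max_eq_left ((min_le_left _ _).trans h), Set.uIoc_of_ge h] at hu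
        exact absurd hu'.1 hu.2.not_gt
      · rcases le_or_gt (G.len e) t with h' | h'
        · rw [min_eq_right h', max_eq_right hlen.le, Set.uIoc_of_le h'] at hu
          exact absurd hu'.2 hu.1.not_gt
        · rw [min_eq_left h'.le, max_eq_right h.le] at hu
          simp at hu
    rw [intervalIntegral.integral_congr_ae (g := fun _ => 0) (ae_of_all _ h0)]
    simp
  have hmain := sub_eq_intervalIntegral_of_weak_deriv hlen (hF.comp (G.continuous_param e)) hgi
    (fun φ hφd hφc hφs => by
      have h1 := (hw e).2.2 φ hφd hφc hφs
      refine h1.trans (congrArg _ (setIntegral_congr_fun measurableSet_Ioo fun u hu => ?_))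
      simp only [hk, Set.indicator_of_mem hu]) (hclamp s) (hclamp t)
  simp only [Function.comp_apply, G.param_clamp] at hmain
  have hii : ∀ a b, IntervalIntegrable k volume a b := fun a b => hgi.intervalIntegrable
  have e1 := intervalIntegral.integral_add_adjacent_intervals
    (hii (max 0 (min s (G.len e))) s) (hii s t)
  have e2 := intervalIntegral.integral_add_adjacent_intervals
    (hii (max 0 (min s (G.len e))) (max 0 (min t (G.len e)))) (hii (max 0 (min t (G.len e))) t)
  rw [hzero] at e1 e2
  rw [hmain]
  linarith

/-- The increment of a function along a path is at most the integral of its weak gradient over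
any measurable set that contains the path. -/
theorem ofReal_abs_sub_le_lintegral [Finite V] [Nontrivial V] {F g : G.Point → ℝ}
    (hF : Continuous F) (hg : Integrable g G.lengthMeasure) (hw : G.IsWeakGradient F g)
    {x y : G.Point} (γ : Path x y) {K : Set G.Point} (hK : MeasurableSet K)
    (hγ : ∀ s, γ s ∈ K) :
    ENNReal.ofReal |F y - F x| ≤ ∫⁻ z in K, ‖g z‖ₑ ∂G.lengthMeasure := by
  have := G.finite_edgeSet
  have hcov : F '' K ⊆ ⋃ e, (fun t => F (G.param e t)) ''
      (G.param e ⁻¹' K ∩ Set.Icc 0 (G.len e)) := by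
    rintro _ ⟨z, hz, rfl⟩
    obtain ⟨e, t, ht, rfl⟩ := G.exists_param_eq z
    exact Set.mem_iUnion.2 ⟨e, t, ⟨hz, ht⟩, rfl⟩
  -- Intermediate values along the path; nothing else about the path is used.
  have himg : Set.uIcc (F x) (F y) ⊆ F '' K := by
    have hpre : IsPreconnected (Set.range fun s => F (γ s)) :=
      isPreconnected_range (hF.comp γ.continuous)
    refine (hpre.ordConnected.uIcc_subset ⟨0, by simp⟩ ⟨1, by simp⟩).trans ?_
    rintro _ ⟨s, rfl⟩
    exact ⟨γ s, hγ s, rfl⟩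
  rw [← Real.volume_interval, G.lintegral_lengthMeasure hg.aestronglyMeasurable.enorm hK]
  refine (measure_mono (himg.trans hcov)).trans ((measure_iUnion_le _).trans ?_)
  refine ENNReal.tsum_le_tsum fun e => ?_
  have hgi : Integrable ((Set.Ioo 0 (G.len e)).indicator (fun u => g (G.param e u))) :=
    ((G.integrableOn_comp_param hg e).mono_set Set.Ioo_subset_Icc_self).integrable_indicator
      measurableSet_Ioo
  refine (volume_image_le_lintegral_enorm hgi
    (G.sub_eq_intervalIntegral_weakGradient hF hg hw e)
    ((G.measurable_param e hK).inter measurableSet_Icc)).trans ?_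
  refine lintegral_mono fun t => ?_
  rw [enorm_indicator_eq_indicator_enorm]
  exact Set.indicator_le_self _ _ _

/-- The squared increment of a function along a path is controlled by the square integral of its
weak gradient over any measurable set that contains the path. -/
theorem sq_sub_le_setIntegral [Finite V] [Nontrivial V] {F g : G.Point → ℝ}
    (hF : Continuous F) (hg : MemLp g 2 G.lengthMeasure) (hw : G.IsWeakGradient F g)
    {x y : G.Point} (γ : Path x y) {K : Set G.Point} (hK : MeasurableSet K)
    (hγ : ∀ s, γ s ∈ K) :
    (F y - F x) ^ 2 ≤
      G.lengthMeasure.real Set.univ * ∫ z in K, g z ^ 2 ∂G.lengthMeasure := by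
  have := G.isFiniteMeasure_lengthMeasure
  have hgi : Integrable g G.lengthMeasure := hg.integrable one_le_two
  have h1 : |F y - F x| ≤ ∫ z in K, |g z| ∂G.lengthMeasure := by
    have h2 := G.ofReal_abs_sub_le_lintegral hF hgi hw γ hK hγ
    rw [← ofReal_integral_norm_eq_lintegral_enorm hgi.integrableOn,
      ENNReal.ofReal_le_ofReal_iff (integral_nonneg fun z => norm_nonneg _)] at h2
    exact h2
  have h3 := sq_integral_le_measureReal_mul (hg.restrict K).abs
  simp only [Pi.abs_apply, sq_abs] at h3
  calc (F y - F x) ^ 2 = |F y - F x| ^ 2 := (sq_abs _).symm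
    _ ≤ (∫ z in K, |g z| ∂G.lengthMeasure) ^ 2 := pow_le_pow_left₀ (abs_nonneg _) h1 2
    _ ≤ _ := h3
    _ ≤ _ := by
      refine mul_le_mul_of_nonneg_right ?_ (integral_nonneg fun z => sq_nonneg _)
      rw [measureReal_restrict_apply_univ]
      exact measureReal_mono (Set.subset_univ _)

/-! ### Integration against the Gibbs measure. -/

theorem measurable_gibbs_density {U : G.Point → ℝ} (hU : Continuous U) (β : ℝ) :
    Measurable fun x => ENNReal.ofReal (Real.exp (-β * U x) / G.partitionFunction U β) := by
  have := hU.measurable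
  fun_prop

theorem gibbs_absolutelyContinuous (U : G.Point → ℝ) (β : ℝ) :
    G.gibbs U β ≪ G.lengthMeasure :=
  withDensity_absolutelyContinuous _ _

section Gibbs

variable [Finite V] [Nontrivial V] {U : G.Point → ℝ} {β : ℝ}

theorem integrable_exp_neg_mul (hU : Continuous U) (β : ℝ) :
    Integrable (fun x => Real.exp (-β * U x)) G.lengthMeasure := by
  have := G.isFiniteMeasure_lengthMeasure
  have := G.compactSpace_point
  have hc : Continuous fun x => Real.exp (-β * U x) := by fun_prop
  exact hc.integrable_of_hasCompactSupport (HasCompactSupport.of_compactSpace _)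

theorem partitionFunction_pos (hU : Continuous U) (β : ℝ) : 0 < G.partitionFunction U β := by
  have : NeZero G.lengthMeasure := ⟨G.lengthMeasure_ne_zero⟩
  exact integral_exp_pos (G.integrable_exp_neg_mul hU β)

theorem partitionFunction_le (hU : Continuous U) (hU0 : ∀ x, 0 ≤ U x) (hβ : 0 ≤ β) :
    G.partitionFunction U β ≤ G.lengthMeasure.real Set.univ := by
  have := G.isFiniteMeasure_lengthMeasure
  calc G.partitionFunction U β ≤ ∫ _, (1 : ℝ) ∂G.lengthMeasure := by
        refine integral_mono (G.integrable_exp_neg_mul hU β) (integrable_const _) fun x => ?_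
        rw [Real.exp_le_one_iff]
        nlinarith [hU0 x]
    _ = _ := by simp

theorem integral_gibbs (hU : Continuous U) (β : ℝ) (h : G.Point → ℝ) :
    ∫ x, h x ∂G.gibbs U β =
      ∫ x, Real.exp (-β * U x) / G.partitionFunction U β * h x ∂G.lengthMeasure := by
  have hZ := G.partitionFunction_pos hU β
  rw [gibbs, integral_withDensity_eq_integral_toReal_smul (G.measurable_gibbs_density hU β)
    (ae_of_all _ fun x => ENNReal.ofReal_lt_top)]
  congr 1
  ext x
  rw [ENNReal.toReal_ofReal (by positivity), smul_eq_mul]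

theorem integrable_gibbs_iff (hU : Continuous U) (β : ℝ) (h : G.Point → ℝ) :
    Integrable h (G.gibbs U β) ↔
      Integrable (fun x => Real.exp (-β * U x) / G.partitionFunction U β * h x)
        G.lengthMeasure := by
  have hZ := G.partitionFunction_pos hU β
  rw [gibbs, integrable_withDensity_iff_integrable_smul' (G.measurable_gibbs_density hU β)
    (ae_of_all _ fun x => ENNReal.ofReal_lt_top)]
  refine integrable_congr (ae_of_all _ fun x => ?_)
  simp only
  rw [ENNReal.toReal_ofReal (by positivity), smul_eq_mul]

theorem isProbabilityMeasure_gibbs (hU : Continuous U) (β : ℝ) :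
    IsProbabilityMeasure (G.gibbs U β) := by
  have hZ := G.partitionFunction_pos hU β
  constructor
  rw [gibbs, withDensity_apply _ MeasurableSet.univ, Measure.restrict_univ,
    ← ofReal_integral_eq_lintegral_ofReal ((G.integrable_exp_neg_mul hU β).div_const _)
      (ae_of_all _ fun x => by positivity), integral_div]
  change ENNReal.ofReal (G.partitionFunction U β / _) = 1
  rw [div_self hZ.ne', ENNReal.ofReal_one]

/-- On a compact graph the Gibbs density attains a positive minimum, so the length measure is at
most a multiple of the Gibbs measure. -/
theorem memLp_lengthMeasure_of_gibbs (hU : Continuous U) (β : ℝ) {g : G.Point → ℝ}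
    (hg : MemLp g 2 (G.gibbs U β)) : MemLp g 2 G.lengthMeasure := by
  have := G.compactSpace_point
  have hZ := G.partitionFunction_pos hU β
  obtain ⟨v, -, -⟩ := exists_pair_ne V
  have : Nonempty G.Point := ⟨Point.vertex v⟩
  have hc : Continuous fun x => Real.exp (-β * U x) / G.partitionFunction U β := by fun_prop
  obtain ⟨x₀, hx₀⟩ := hc.exists_forall_le_of_hasCompactSupport
    (HasCompactSupport.of_compactSpace _)
  set m := Real.exp (-β * U x₀) / G.partitionFunction U β
  have hm : ENNReal.ofReal m ≠ 0 := by
    rw [ne_eq, ENNReal.ofReal_eq_zero, not_le]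
    positivity
  have hle : ENNReal.ofReal m • G.lengthMeasure ≤ G.gibbs U β := by
    rw [← withDensity_const, gibbs]
    exact withDensity_mono (ae_of_all _ fun x => ENNReal.ofReal_le_ofReal (hx₀ x))
  refine (hg.mono_measure hle).of_measure_le_smul (c := (ENNReal.ofReal m)⁻¹)
    (ENNReal.inv_ne_top.2 hm) ?_
  rw [smul_smul, ENNReal.inv_mul_cancel hm ENNReal.ofReal_ne_top, one_smul]

/-- The increment of a function along a path on which `U ≤ h` is controlled by its Dirichlet
form and `h`. -/
theorem sq_sub_le_of_path (hU : Continuous U) (hβ : 0 ≤ β) {F g : G.Point → ℝ}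
    (hF : Continuous F) (hg : MemLp g 2 (G.gibbs U β)) (hw : G.IsWeakGradient F g)
    {x y : G.Point} (γ : Path x y) {h : ℝ} (hγ : ∀ s, U (γ s) ≤ h) :
    (F y - F x) ^ 2 ≤ G.lengthMeasure.real Set.univ * Real.exp (β * h) *
      G.partitionFunction U β * ∫ z, g z ^ 2 ∂G.gibbs U β := by
  have hZ := G.partitionFunction_pos hU β
  have hg' := G.memLp_lengthMeasure_of_gibbs hU β hg
  have hK : MeasurableSet {z | U z ≤ h} := (isClosed_le hU continuous_const).measurableSet
  have hi := (G.integrable_gibbs_iff hU β _).1 hg.integrable_sq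
  refine (G.sq_sub_le_setIntegral hF hg' hw γ hK hγ).trans ?_
  rw [mul_assoc, mul_assoc, G.integral_gibbs hU]
  refine mul_le_mul_of_nonneg_left ?_ measureReal_nonneg
  rw [← integral_const_mul, ← integral_const_mul]
  calc ∫ z in {z | U z ≤ h}, g z ^ 2 ∂G.lengthMeasure
      ≤ ∫ z in {z | U z ≤ h}, Real.exp (β * h) * (G.partitionFunction U β *
          (Real.exp (-β * U z) / G.partitionFunction U β * g z ^ 2)) ∂G.lengthMeasure := by
        refine setIntegral_mono_on hg'.integrable_sq.integrableOn
          ((hi.const_mul _).const_mul _).integrableOn hK fun z hz => ?_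
        -- The density cancels `Z_β`, leaving the factor `e^{β (h - U z)}`, which is at least `1` on
        -- the sublevel set.
        have e1 : Real.exp (β * h) * (G.partitionFunction U β *
            (Real.exp (-β * U z) / G.partitionFunction U β * g z ^ 2)) =
            Real.exp (β * h + -β * U z) * g z ^ 2 := by
          rw [Real.exp_add]
          field_simp
        rw [e1]
        refine le_mul_of_one_le_left (sq_nonneg _) (Real.one_le_exp ?_)
        have := mul_le_mul_of_nonneg_left (show U z ≤ h from hz) hβ
        linarith
    _ ≤ _ := setIntegral_le_integral ((hi.const_mul _).const_mul _)
        (ae_of_all _ fun z => by positivity)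

end Gibbs

/-- The defining identity sees `f` only through integrals over edges, so a function and its
continuous representative share their weak gradients. -/
theorem IsWeakGradient.congr_ae {f F g : G.Point → ℝ} (h : G.IsWeakGradient f g)
    (hF : Continuous F) (hfF : f =ᵐ[G.lengthMeasure] F) : G.IsWeakGradient F g := by
  intro e
  obtain ⟨-, h2, h3⟩ := h e
  refine ⟨(hF.comp (G.continuous_param e)).locallyIntegrable.locallyIntegrableOn _, h2,
    fun φ hφd hφc hφs => ?_⟩
  rw [← h3 φ hφd hφc hφs]
  have hae : ∀ᵐ t ∂volume.restrict (Set.Icc 0 (G.len e)),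
      f (G.param e t) = F (G.param e t) :=
    ae_of_ae_map (G.measurable_param e).aemeasurable
      ((Measure.absolutelyContinuous_of_le (G.restrict_volume_map_param_le e)).ae_le hfF)
  refine integral_congr_ae ?_
  filter_upwards [ae_restrict_of_ae_restrict_of_subset Set.Ioo_subset_Icc_self hae] with t ht
  rw [ht]

/-! ### The elevation and the constant `c⋆` -/

section Elevation

variable {U : G.Point → ℝ} {B : ℝ}

theorem iSup_path_nonneg (hU0 : ∀ x, 0 ≤ U x) {x y : G.Point} (γ : Path x y) :
    0 ≤ ⨆ s, U (γ s) :=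
  Real.iSup_nonneg fun s => hU0 (γ s)

theorem le_iSup_path (hUB : ∀ x, U x ≤ B) {x y : G.Point} (γ : Path x y) (s : unitInterval) :
    U (γ s) ≤ ⨆ s, U (γ s) :=
  le_ciSup (f := fun s => U (γ s)) ⟨B, by rintro _ ⟨s, rfl⟩; exact hUB _⟩ s

theorem bddBelow_iSup_path (hU0 : ∀ x, 0 ≤ U x) (x y : G.Point) :
    BddBelow (Set.range fun γ : Path x y => ⨆ s, U (γ s)) :=
  ⟨0, by rintro _ ⟨γ, rfl⟩; exact G.iSup_path_nonneg hU0 γ⟩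

variable [Nontrivial V]

theorem elevation_le (hU0 : ∀ x, 0 ≤ U x) (hUB : ∀ x, U x ≤ B) (x y : G.Point) :
    G.elevation U x y ≤ B := by
  obtain ⟨γ⟩ := G.joined x y
  exact (ciInf_le (G.bddBelow_iSup_path hU0 x y) γ).trans (ciSup_le fun s => hUB _)

theorem le_elevation (hUB : ∀ x, U x ≤ B) (x y : G.Point) : U x ≤ G.elevation U x y := by
  have : Nonempty (Path x y) := G.joined x y
  refine le_ciInf fun γ => ?_
  simpa using G.le_iSup_path hUB γ 0

theorem exists_path_lt (hUB : ∀ x, U x ≤ B) (x y : G.Point) {ε : ℝ} (hε : 0 < ε) :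
    ∃ γ : Path x y, ∀ s, U (γ s) ≤ G.elevation U x y + ε := by
  have : Nonempty (Path x y) := G.joined x y
  obtain ⟨γ, hγ⟩ := exists_lt_of_ciInf_lt (lt_add_of_pos_right (G.elevation U x y) hε)
  exact ⟨γ, fun s => (G.le_iSup_path hUB γ s).trans hγ.le⟩

theorem elevation_sub_sub_add_iInf_le_cStar (hU0 : ∀ x, 0 ≤ U x) (hUB : ∀ x, U x ≤ B)
    (x y : G.Point) : G.elevation U x y - U x - U y + ⨅ z, U z ≤ G.cStar U := by
  refine add_le_add_left ?_ _
  -- The bound `B` on the family is essential: the real supremum of an unbounded family would be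
  -- `0`.
  refine le_ciSup (f := fun p : G.Point × G.Point => G.elevation U p.1 p.2 - U p.1 - U p.2)
    ⟨B, ?_⟩ (x, y)
  rintro _ ⟨p, rfl⟩
  have := G.elevation_le hU0 hUB p.1 p.2
  have := hU0 p.1
  have := hU0 p.2
  dsimp only
  linarith

end Elevation

variable [Finite V] [Nontrivial V] {U : G.Point → ℝ} {β B : ℝ}

theorem exists_eq_iInf (hU : Continuous U) : ∃ x₀, U x₀ = ⨅ z, U z := by
  have := G.compactSpace_point
  obtain ⟨v, -, -⟩ := exists_pair_ne V
  have : Nonempty G.Point := ⟨Point.vertex v⟩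
  obtain ⟨x₀, hx₀⟩ := hU.exists_forall_le_of_hasCompactSupport (HasCompactSupport.of_compactSpace _)
  exact ⟨x₀, le_antisymm (le_ciInf hx₀) (ciInf_le ⟨U x₀, by rintro _ ⟨z, rfl⟩; exact hx₀ z⟩ x₀)⟩

/-- Take both points equal to a minimum of `U`. This makes `e^{c⋆ β} ≥ 1`, as the entropy estimate
needs. -/
theorem cStar_nonneg (hU : Continuous U) (hU0 : ∀ x, 0 ≤ U x) (hUB : ∀ x, U x ≤ B) :
    0 ≤ G.cStar U := by
  obtain ⟨x₀, hx₀⟩ := G.exists_eq_iInf hU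
  have h1 := G.elevation_sub_sub_add_iInf_le_cStar hU0 hUB x₀ x₀
  have h2 := G.le_elevation hUB x₀ x₀
  linarith

/-! ### Poincaré, oscillation and logarithmic Sobolev inequalities. -/

section Estimates

variable {F g : G.Point → ℝ}

theorem sq_sub_le_exp_elevation (hU : Continuous U) (hUB : ∀ x, U x ≤ B)
    (hβ : 0 ≤ β) (hF : Continuous F) (hg : MemLp g 2 (G.gibbs U β)) (hw : G.IsWeakGradient F g)
    (x y : G.Point) :
    (F y - F x) ^ 2 ≤ G.lengthMeasure.real Set.univ * Real.exp (β * G.elevation U x y) *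
      G.partitionFunction U β * ∫ z, g z ^ 2 ∂G.gibbs U β := by
  -- The infimum over paths is not known to be attained, so paths of height `H + ε` are used and `ε`
  -- tends to `0`.
  have hlim : Filter.Tendsto (fun ε : ℝ => G.lengthMeasure.real Set.univ *
      Real.exp (β * (G.elevation U x y + ε)) * G.partitionFunction U β *
        ∫ z, g z ^ 2 ∂G.gibbs U β) (nhdsWithin 0 (Set.Ioi 0))
      (nhds (G.lengthMeasure.real Set.univ * Real.exp (β * (G.elevation U x y + 0)) *
        G.partitionFunction U β * ∫ z, g z ^ 2 ∂G.gibbs U β)) := by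
    refine Filter.Tendsto.mono_left (Continuous.tendsto ?_ 0) nhdsWithin_le_nhds
    fun_prop
  rw [add_zero] at hlim
  refine ge_of_tendsto hlim ?_
  filter_upwards [self_mem_nhdsWithin] with ε hε
  obtain ⟨γ, hγ⟩ := G.exists_path_lt hUB x y hε
  exact G.sq_sub_le_of_path hU hβ hF hg hw γ hγ

/-- The Poincaré inequality, centred at the value at a minimum of `U`. -/
theorem integral_sq_sub_le (hU : Continuous U) (hU0 : ∀ x, 0 ≤ U x) (hUB : ∀ x, U x ≤ B)
    (hβ : 0 ≤ β) (hF : Continuous F) (hg : MemLp g 2 (G.gibbs U β)) (hw : G.IsWeakGradient F g) :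
    ∃ c, ∫ x, (F x - c) ^ 2 ∂G.gibbs U β ≤
      G.lengthMeasure.real Set.univ ^ 2 * Real.exp (G.cStar U * β) *
        ∫ z, g z ^ 2 ∂G.gibbs U β := by
  have := G.isFiniteMeasure_lengthMeasure
  obtain ⟨x₀, hx₀⟩ := G.exists_eq_iInf hU
  have hZ := G.partitionFunction_pos hU β
  refine ⟨F x₀, ?_⟩
  set T := ∫ z, g z ^ 2 ∂G.gibbs U β
  have hT : 0 ≤ T := integral_nonneg fun z => sq_nonneg _
  set l := G.lengthMeasure.real Set.univ with hl
  have hl0 : 0 ≤ l := measureReal_nonneg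
  have hpt : ∀ x, Real.exp (-β * U x) / G.partitionFunction U β * (F x - F x₀) ^ 2 ≤
      l * Real.exp (G.cStar U * β) * T := by
    intro x
    have h1 := G.sq_sub_le_exp_elevation hU hUB hβ hF hg hw x x₀
    have h2 := G.elevation_sub_sub_add_iInf_le_cStar hU0 hUB x x₀
    -- With `x₀` a minimum of `U`, `-U x₀` and the added `min U` cancel, leaving `H(x, x₀) - U x ≤
    -- c⋆`.
    rw [← hx₀, sub_add_cancel] at h2
    rw [← neg_sub, neg_sq]
    calc Real.exp (-β * U x) / G.partitionFunction U β * (F x₀ - F x) ^ 2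
        ≤ Real.exp (-β * U x) / G.partitionFunction U β *
          (l * Real.exp (β * G.elevation U x x₀) * G.partitionFunction U β * T) :=
          mul_le_mul_of_nonneg_left h1 (by positivity)
      _ = l * Real.exp (β * (G.elevation U x x₀ - U x)) * T := by
          rw [show β * (G.elevation U x x₀ - U x) = -β * U x + β * G.elevation U x x₀ by ring,
            Real.exp_add]
          field_simp
      _ ≤ l * Real.exp (G.cStar U * β) * T := by
          rw [mul_comm (G.cStar U) β]
          gcongr
  rw [G.integral_gibbs hU]
  calc ∫ x, Real.exp (-β * U x) / G.partitionFunction U β * (F x - F x₀) ^ 2 ∂G.lengthMeasure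
      ≤ ∫ _, l * Real.exp (G.cStar U * β) * T ∂G.lengthMeasure :=
        integral_mono_of_nonneg (ae_of_all _ fun x => by positivity) (integrable_const _)
          (ae_of_all _ hpt)
    _ = l ^ 2 * Real.exp (G.cStar U * β) * T := by
        rw [integral_const, smul_eq_mul, ← hl]
        ring

/-- The exponent `β B` is far from optimal, which is harmless: this bound enters the entropy
estimate only through a logarithm. -/
theorem sq_sub_le_exp (hU : Continuous U) (hU0 : ∀ x, 0 ≤ U x) (hUB : ∀ x, U x ≤ B)
    (hβ : 0 ≤ β) (hF : Continuous F) (hg : MemLp g 2 (G.gibbs U β)) (hw : G.IsWeakGradient F g)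
    (x y : G.Point) :
    (F x - F y) ^ 2 ≤ G.lengthMeasure.real Set.univ ^ 2 * Real.exp (β * B) *
      ∫ z, g z ^ 2 ∂G.gibbs U β := by
  have h1 := G.sq_sub_le_exp_elevation hU hUB hβ hF hg hw y x
  have h2 := G.elevation_le hU0 hUB y x
  have h3 := G.partitionFunction_le hU hU0 hβ
  have hZ := G.partitionFunction_pos hU β
  have hl0 : 0 ≤ G.lengthMeasure.real Set.univ := measureReal_nonneg
  have hT : 0 ≤ ∫ z, g z ^ 2 ∂G.gibbs U β := integral_nonneg fun z => sq_nonneg _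
  calc (F x - F y) ^ 2 ≤ _ := h1
    _ ≤ G.lengthMeasure.real Set.univ * Real.exp (β * B) * G.lengthMeasure.real Set.univ *
        ∫ z, g z ^ 2 ∂G.gibbs U β := by gcongr
    _ = _ := by ring

/-- The logarithmic Sobolev inequality for a continuous function. -/
theorem integral_sq_mul_log_div_le_dirichlet (hU : Continuous U) (hU0 : ∀ x, 0 ≤ U x)
    (hUB : ∀ x, U x ≤ B) (hB : 0 ≤ B) (hβ : 0 ≤ β) (hF : Continuous F)
    (hg : MemLp g 2 (G.gibbs U β)) (hw : G.IsWeakGradient F g) :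
    ∫ x, F x ^ 2 * Real.log (F x ^ 2 / ∫ y, F y ^ 2 ∂G.gibbs U β) ∂G.gibbs U β ≤
      (18 + 8 * Real.log (2 * (1 + G.lengthMeasure.real Set.univ ^ 2)) + 8 * B) *
        (1 + G.lengthMeasure.real Set.univ ^ 2) * (1 + β) * Real.exp (G.cStar U * β) *
          ∫ z, g z ^ 2 ∂G.gibbs U β := by
  have := G.isProbabilityMeasure_gibbs hU β
  have := G.compactSpace_point
  obtain ⟨M, hM⟩ := (isCompact_range hF.abs).bddAbove
  obtain ⟨c, hc⟩ := G.integral_sq_sub_le hU hU0 hUB hβ hF hg hw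
  have hosc := G.sq_sub_le_exp hU hU0 hUB hβ hF hg hw
  have hcs := G.cStar_nonneg hU hU0 hUB
  set T := ∫ z, g z ^ 2 ∂G.gibbs U β
  have hT : 0 ≤ T := integral_nonneg fun z => sq_nonneg _
  set l := G.lengthMeasure.real Set.univ
  have hl : l ^ 2 ≤ 1 + l ^ 2 := by linarith
  have hl1 : 1 ≤ 1 + l ^ 2 := by linarith [sq_nonneg l]
  -- Replacing `l²` by `1 + l²` makes both constants at least `1` whatever the total length.
  have hP : 1 ≤ (1 + l ^ 2) * Real.exp (G.cStar U * β) :=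
    one_le_mul_of_one_le_of_one_le hl1 (Real.one_le_exp (mul_nonneg hcs hβ))
  have hR : 1 ≤ (1 + l ^ 2) * Real.exp (β * B) :=
    one_le_mul_of_one_le_of_one_le hl1 (Real.one_le_exp (mul_nonneg hβ hB))
  have key := integral_sq_mul_log_div_le (μ := G.gibbs U β) hF.aestronglyMeasurable
    (fun x => hM ⟨x, rfl⟩) hP hR hT (c := c) (hc.trans (by gcongr))
    (fun x y => (hosc x y).trans (by gcongr))
  have hlog : Real.log (2 * ((1 + l ^ 2) * Real.exp (β * B))) =
      Real.log (2 * (1 + l ^ 2)) + β * B := by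
    rw [← mul_assoc, Real.log_mul (by positivity) (Real.exp_pos _).ne', Real.log_exp]
  rw [hlog] at key
  have hlog0 : 0 ≤ Real.log (2 * (1 + l ^ 2)) := Real.log_nonneg (by linarith)
  refine key.trans ?_
  have hfac : 18 + 8 * (Real.log (2 * (1 + l ^ 2)) + β * B) ≤
      (18 + 8 * Real.log (2 * (1 + l ^ 2)) + 8 * B) * (1 + β) := by
    nlinarith [mul_nonneg hlog0 hβ]
  calc _ ≤ (18 + 8 * Real.log (2 * (1 + l ^ 2)) + 8 * B) * (1 + β) *
        ((1 + l ^ 2) * Real.exp (G.cStar U * β)) * T := by gcongr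
    _ = _ := by ring

end Estimates

theorem integrable_entropyIntegrand (hU : Continuous U) (β : ℝ) {F : G.Point → ℝ}
    (hF : Continuous F) : Integrable (G.entropyIntegrand (G.gibbs U β) F) (G.gibbs U β) := by
  have := G.isProbabilityMeasure_gibbs hU β
  have := G.compactSpace_point
  unfold entropyIntegrand
  generalize ∫ y, F y ^ 2 ∂G.gibbs U β = N
  rcases eq_or_ne N 0 with rfl | hN
  · simp
  -- Rewritten through `t log t`, which is continuous also at `t = 0`, so zeros of `F` do no harm.
  have h : (fun x => F x ^ 2 * Real.log (F x ^ 2 / N)) =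
      fun x => N * ((F x ^ 2 / N) * Real.log (F x ^ 2 / N)) := by
    ext x
    field_simp
  have hc : Continuous fun x => F x ^ 2 * Real.log (F x ^ 2 / N) := by
    rw [h]
    exact continuous_const.mul (Real.continuous_mul_log.comp ((hF.pow 2).div_const N))
  exact hc.integrable_of_hasCompactSupport (HasCompactSupport.of_compactSpace _)

end WeightedGraph

/-! ### Passage from the continuous representative to a general Sobolev function. -/

theorem mainTheorem5 {V : Type*} [Fintype V] [Nontrivial V] (G : WeightedGraph V) :
    ∃ C : ℝ, 0 < C ∧
      ∀ ν ∈ stdSimplex ℝ V, ∀ β : ℝ, 0 ≤ β →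
        ∀ f : G.Point → ℝ, G.MemW12 (G.gibbs (G.energy ν) β) f →
          Integrable (G.entropyIntegrand (G.gibbs (G.energy ν) β) f)
              (G.gibbs (G.energy ν) β) ∧
            G.entropySq (G.gibbs (G.energy ν) β) f ≤
              C * (1 + β) * Real.exp (G.cStar (G.energy ν) * β) *
                G.dirichletForm (G.gibbs (G.energy ν) β) f := by
  obtain ⟨B, hB, hUB⟩ := G.exists_energy_le
  have hlog : 0 ≤ Real.log (2 * (1 + G.lengthMeasure.real Set.univ ^ 2)) :=
    Real.log_nonneg (by linarith [sq_nonneg (G.lengthMeasure.real Set.univ)])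
  refine ⟨(18 + 8 * Real.log (2 * (1 + G.lengthMeasure.real Set.univ ^ 2)) + 8 * B) *
    (1 + G.lengthMeasure.real Set.univ ^ 2), by positivity, fun ν hν β hβ f hf => ?_⟩
  have hU := G.continuous_energy ν
  obtain ⟨F, hF, hfF⟩ := hf.continuous_rep
  -- The chosen gradient of `f` also serves as the gradient of `F`, so the Dirichlet form is
  -- unchanged and uniqueness of weak gradients is not needed.
  have hgrad : G.IsWeakGradient f (G.weakGradient f) := by
    rw [WeightedGraph.weakGradient, dif_pos hf.weaklyDifferentiable]
    exact hf.weaklyDifferentiable.choose_spec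
  have hfF' : f =ᵐ[G.gibbs (G.energy ν) β] F :=
    (G.gibbs_absolutelyContinuous (G.energy ν) β).ae_le hfF
  have hN : ∫ y, f y ^ 2 ∂G.gibbs (G.energy ν) β = ∫ y, F y ^ 2 ∂G.gibbs (G.energy ν) β :=
    integral_congr_ae (hfF'.mono fun x hx => by simp only [hx])
  have hent : G.entropyIntegrand (G.gibbs (G.energy ν) β) f =ᵐ[G.gibbs (G.energy ν) β]
      G.entropyIntegrand (G.gibbs (G.energy ν) β) F :=
    hfF'.mono fun x hx => by simp only [WeightedGraph.entropyIntegrand, hx, hN]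
  refine ⟨(G.integrable_entropyIntegrand hU β hF).congr hent.symm, ?_⟩
  rw [WeightedGraph.entropySq, integral_congr_ae hent]
  exact G.integral_sq_mul_log_div_le_dirichlet hU (G.energy_nonneg hν) (hUB ν hν) hB hβ hF
    hf.memLp_weakGradient (hgrad.congr_ae G hF hfF)
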